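/- Let $\Gamma$ be a connected $3$-regular graph (loops and multiple edges permitted; a loop counts twice at its vertex) with an orientation, i.e. a cyclic ordering of the half-edges at every vertex. Let $T$ be the ideal triangle in the hyperbolic plane $\mathbb{H}=\{\operatorname{Im} z>0\}$ with vertices $0,1,\infty$ and with tick-marks $i,\ \tfrac{1+i}{2},\ 1+i$ on its sides. Paste one copy of $T$ on each vertex $v$ of $\Gamma$, matching the three successive half-edges at $v$, in their cyclic order, with the three sides of $T$ in counterclockwise order. Choose a spanning tree of $\Gamma$ and place these triangles in $\mathbb{H}$ by orientation-preserving isometries so that, for each edge of the tree, the triangles at its two ends are adjacent along the sides belonging to this edge, tick-mark on tick-mark; this gives a polygon $\Pi$. For each half-edge $d$ outside the tree, with opposite half-edge $\bar d$, let $A_d$ be the orientation-preserving isometry of $\mathbb{H}$ which takes the side of $\Pi$ belonging to $\bar d$ to the side belonging to $d$, tick-mark to tick-mark, and takes the triangle containing the former side to the other side of the latter. Let $G$ be the group generated by all the $A_d$, and let $S^O(\Gamma)=\mathbb{H}/G$, with the complex structure and the hyperbolic metric induced from $\mathbb{H}$. Then every orientation-preserving automorphism $\varphi$ of $\Gamma$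 (an automorphism of the graph that preserves the cyclic orderings) induces an automorphism of $S^O(\Gamma)$: there is a conformal automorphism $F$ of $S^O(\Gamma)$ which is an isometry of its hyperbolic metric and which, for every vertex $v$, maps the triangle of $S^O(\Gamma)$ at $v$ to the triangle at $\varphi(v)$ by the isomorphism of marked ideal triangles that takes the side belonging to each half-edge $d$ at $v$ to the side belonging to $\varphi(d)$. -/

import Mathlib

open UpperHalfPlane
open scoped MatrixGroups Manifold Pointwise

/-! ### Graphs with loops and multiple edges, orientations, automorphisms -/

/-- A graph with vertex set `V`, loops and multiple edges permitted, presented by its half-edges: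
`base d` is the vertex from which the half-edge `d` emanates, and an edge is a pair
`{d, inv d}` of distinct half-edges (a loop has both of its half-edges at the same vertex). -/
structure HalfEdgeGraph (V D : Type*) where
  base : D → V
  inv : D → D
  inv_inv : ∀ d, inv (inv d) = d
  inv_ne : ∀ d, inv d ≠ d

namespace HalfEdgeGraph

variable {V D : Type*}

/-- There are exactly three edges incident at each vertex, loops being counted twice. -/
def IsThreeRegular (Γ : HalfEdgeGraph V D) : Prop :=
  ∀ v, {d | Γ.base d = v}.ncard = 3

/-- A cyclic ordering, at every vertex, of the half-edges emanating from it; `next d` is the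
successor of `d`. -/
structure Orientation (Γ : HalfEdgeGraph V D) where
  next : Equiv.Perm D
  base_next : ∀ d, Γ.base (next d) = Γ.base d
  cyclic : ∀ d e, Γ.base d = Γ.base e → ∃ n : ℕ, (next ^ n) d = e

/-- An automorphism of a graph: bijections of the vertices and of the half-edges that respect
incidence and edges. -/
structure Aut (Γ : HalfEdgeGraph V D) where
  onVert : Equiv.Perm V
  onHalf : Equiv.Perm D
  base_onHalf : ∀ d, Γ.base (onHalf d) = onVert (Γ.base d)
  inv_onHalf : ∀ d, Γ.inv (onHalf d) = onHalf (Γ.inv d)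

/-- The automorphism respects the cyclic ordering at every vertex. -/
def Aut.OrientationPreserving {Γ : HalfEdgeGraph V D} (φ : Γ.Aut) (o : Γ.Orientation) : Prop :=
  ∀ d, φ.onHalf (o.next d) = o.next (φ.onHalf d)

/-- The list `l` of half-edges is a walk from `v` to `w`. -/
def IsWalk (Γ : HalfEdgeGraph V D) (v w : V) : List D → Prop
  | [] => v = w
  | d :: l => Γ.base d = v ∧ Γ.IsWalk (Γ.base (Γ.inv d)) w l

/-- A walk without backtracking. -/
def IsReduced (Γ : HalfEdgeGraph V D) (l : List D) : Prop :=
  l.IsChain (fun d e => e ≠ Γ.inv d)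

/-- The edges with half-edges in `t` form a spanning tree: any two vertices are joined by exactly
one walk without backtracking in `t`. -/
def IsSpanningTree (Γ : HalfEdgeGraph V D) (t : Set D) : Prop :=
  Nonempty V ∧ (∀ d ∈ t, Γ.inv d ∈ t) ∧
    ∀ v w, ∃! l : List D, Γ.IsWalk v w l ∧ Γ.IsReduced l ∧ ∀ d ∈ l, d ∈ t

end HalfEdgeGraph

/-! ### The standard marked ideal triangle, in the upper half-plane -/

namespace IdealTriangle

/-- The ideal triangle with vertices `0`, `1`, `∞`. -/
def triangle : Set ℍ := {z | 0 ≤ z.re ∧ z.re ≤ 1 ∧ 1 / 2 ≤ ‖(z : ℂ) - 1 / 2‖}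

/-- `z ↦ 1 / (1 - z)`: the rotation of the triangle by `2π/3`, counterclockwise. -/
def rot : SL(2, ℝ) := ⟨!![0, 1; -1, 1], by simp [Matrix.det_fin_two]⟩

/-- `z ↦ -1 / z`: the half-turn about the tick-mark `i` of the side from `0` to `∞`. -/
def flip : SL(2, ℝ) := ⟨!![0, -1; 1, 0], by simp [Matrix.det_fin_two]⟩

/-- The three tick-marks, `i`, `(1 + i) / 2`, `1 + i`, in counterclockwise order. -/
noncomputable def tick (k : ZMod 3) : ℍ := rot ^ k.val • UpperHalfPlane.I

/-- The three sides, in counterclockwise order; `side 0` runs from `0` to `∞`. -/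
noncomputable def side (k : ZMod 3) : Set ℍ := rot ^ k.val • {z : ℍ | z.re = 0}

/-- The orientation-preserving isometry that pastes a second copy of the triangle along its
`k'`-th side to the `k`-th side of the triangle, tick-mark on tick-mark (see `glue_tick`,
`glue_side` and `triangle_inter_glue`). -/
def glue (k k' : ZMod 3) : SL(2, ℝ) := rot ^ k.val * flip * (rot ^ k'.val)⁻¹

theorem coe_rot (z : ℍ) : ((rot • z : ℍ) : ℂ) = 1 / (1 - z) := by
  rw [UpperHalfPlane.specialLinearGroup_apply]
  simp [rot]; ring

theorem coe_flip (z : ℍ) : ((flip • z : ℍ) : ℂ) = -1 / z := by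
  rw [UpperHalfPlane.specialLinearGroup_apply]
  simp [flip]

theorem mem_triangle (z : ℍ) :
    z ∈ triangle ↔ 0 ≤ z.re ∧ z.re ≤ 1 ∧ z.re ≤ z.re ^ 2 + z.im ^ 2 := by
  have : (1 / 2 ≤ ‖(z : ℂ) - 1 / 2‖) ↔ z.re ≤ z.re ^ 2 + z.im ^ 2 := by
    rw [← sq_le_sq₀ (by norm_num) (norm_nonneg _), ← Complex.normSq_eq_norm_sq,
      Complex.normSq_apply]
    simp
    constructor <;> intro h <;> nlinarith
  simp [triangle, ← this]

theorem rot_mem_triangle {z : ℍ} (h : z ∈ triangle) : rot • z ∈ triangle := by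
  have hre : (rot • z).re = (1 - z.re) / ((1 - z.re) ^ 2 + z.im ^ 2) := by
    rw [← UpperHalfPlane.coe_re, coe_rot]
    simp [Complex.inv_re, Complex.normSq_apply]; ring
  have him : (rot • z).im = z.im / ((1 - z.re) ^ 2 + z.im ^ 2) := by
    rw [← UpperHalfPlane.coe_im, coe_rot]
    simp [Complex.inv_im, Complex.normSq_apply]; ring
  rw [mem_triangle] at *
  rw [hre, him]
  have hp : 0 < (1 - z.re) ^ 2 + z.im ^ 2 := by have := z.im_pos; positivity
  refine ⟨div_nonneg (by linarith) hp.le, ?_, ?_⟩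
  · rw [div_le_one hp]; nlinarith
  · rw [div_pow, div_pow, ← add_div, div_le_div_iff₀ hp (by positivity)]
    nlinarith [mul_nonneg h.1 hp.le]

theorem rot_rot_rot (z : ℍ) : rot • rot • rot • z = z := by
  apply UpperHalfPlane.ext
  have hz : (z : ℂ) ≠ 0 := UpperHalfPlane.ne_zero z
  have h1 : 1 - (z : ℂ) ≠ 0 := fun h => by
    have := congrArg Complex.im h
    simp [z.im_ne_zero] at this
  rw [coe_rot, coe_rot, coe_rot]
  have h2 : 1 - 1 / (1 - (z : ℂ)) = -z / (1 - z) := by field_simp; ring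
  rw [h2]
  field_simp
  ring

theorem rot_smul_triangle : rot • triangle = triangle := by
  apply Set.Subset.antisymm
  · rintro _ ⟨z, hz, rfl⟩
    exact rot_mem_triangle hz
  · intro z hz
    refine ⟨rot • rot • z, rot_mem_triangle (rot_mem_triangle hz), ?_⟩
    change rot • rot • rot • z = z
    exact rot_rot_rot z

theorem rot_pow_smul_triangle (n : ℕ) : rot ^ n • triangle = triangle := by
  induction n with
  | zero => rw [pow_zero, one_smul]
  | succ n ih => rw [pow_succ, mul_smul, rot_smul_triangle, ih]

theorem glue_tick (k k' : ZMod 3) : glue k k' • tick k' = tick k := by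
  have h : flip • UpperHalfPlane.I = UpperHalfPlane.I := by
    apply UpperHalfPlane.ext
    rw [coe_flip]
    simp [div_eq_mul_inv]
  simp only [glue, tick, mul_smul, inv_smul_smul, h]

theorem flip_re (z : ℍ) : (flip • z).re = -z.re / (z.re ^ 2 + z.im ^ 2) := by
  rw [← UpperHalfPlane.coe_re, coe_flip]
  simp [Complex.div_re, Complex.normSq_apply]; ring

theorem flip_flip (z : ℍ) : flip • flip • z = z := by
  apply UpperHalfPlane.ext
  rw [coe_flip, coe_flip]
  simp [div_eq_mul_inv]

theorem glue_side (k k' : ZMod 3) : glue k k' • side k' = side k := by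
  have h : flip • {z : ℍ | z.re = 0} = {z : ℍ | z.re = 0} := by
    apply Set.Subset.antisymm
    · rintro _ ⟨z, hz, rfl⟩
      simp_all [flip_re]
    · intro z hz
      exact ⟨flip • z, by simp_all [flip_re], flip_flip z⟩
  simp only [glue, side, mul_smul, inv_smul_smul, h]

theorem triangle_inter_glue (k k' : ZMod 3) : triangle ∩ glue k k' • triangle = side k := by
  have h : triangle ∩ flip • triangle = {z : ℍ | z.re = 0} := by
    ext z
    constructor
    · rintro ⟨hz, w, hw, rfl⟩
      change flip • w ∈ triangle at hz
      rw [mem_triangle] at hz hw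
      have hp : 0 < w.re ^ 2 + w.im ^ 2 := by have := w.im_pos; positivity
      have h1 := hz.1
      rw [flip_re, le_div_iff₀ hp] at h1
      change (flip • w).re = 0
      rw [flip_re, show w.re = 0 by linarith [hw.1]]
      simp
    · intro hz
      have key : ∀ u : ℍ, u.re = 0 → u ∈ triangle := fun u hu => by
        rw [mem_triangle, hu]; exact ⟨le_rfl, zero_le_one, by positivity⟩
      have hz' : z.re = 0 := hz
      exact ⟨key z hz', flip • z, key _ (by rw [flip_re, hz']; simp), flip_flip z⟩
  have hinv : (rot ^ k'.val)⁻¹ • triangle = triangle := by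
    rw [inv_smul_eq_iff, rot_pow_smul_triangle]
  rw [glue, mul_smul, mul_smul, hinv, side, ← h, Set.smul_set_inter, rot_pow_smul_triangle]

end IdealTriangle

/-! ### The polygon, the side pairings and the surface -/

section Surface

open IdealTriangle

variable {V D : Type*}

/-- A polygon obtained by pasting copies of the standard marked ideal triangle in the hyperbolic
plane, one for each vertex of `Γ`. The sides of the triangle at `v` are matched, by `label`, with
the three successive half-edges at `v`; the triangle at `v` is placed as `place v • triangle`; and
the triangles at the two ends of every edge of a spanning tree `tree` are adjacent along the sides
that belong to this edge, tick-mark on tick-mark. -/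
structure IdealPolygon (Γ : HalfEdgeGraph V D) (o : Γ.Orientation) where
  label : D → ZMod 3
  label_next : ∀ d, label (o.next d) = label d + 1
  tree : Set D
  isSpanningTree : Γ.IsSpanningTree tree
  place : V → SL(2, ℝ)
  place_tree : ∀ d ∈ tree, ∀ z : ℍ,
    place (Γ.base (Γ.inv d)) • z =
      place (Γ.base d) • glue (label d) (label (Γ.inv d)) • z

namespace IdealPolygon

variable {Γ : HalfEdgeGraph V D} {o : Γ.Orientation}

/-- The side-pairing transformation of the half-edge `d`. It takes the side of `inv d` to the side
of `d`, tick-mark to tick-mark, and the triangle at the base of `inv d` to the neighbour, across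
the side of `d`, of the triangle at the base of `d`. -/
def sidePairing (P : IdealPolygon Γ o) (d : D) : SL(2, ℝ) :=
  P.place (Γ.base d) * glue (P.label d) (P.label (Γ.inv d)) * (P.place (Γ.base (Γ.inv d)))⁻¹

/-- The group generated by the side pairings; the sides of the polygon are those of the half-edges
outside the tree. -/
def pairingGroup (P : IdealPolygon Γ o) : Subgroup SL(2, ℝ) :=
  Subgroup.closure (P.sidePairing '' P.treeᶜ)

/-- The surface: the quotient of the hyperbolic plane by the group of the side pairings, with the
quotient topology. -/
abbrev Surface (P : IdealPolygon Γ o) : Type :=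
  MulAction.orbitRel.Quotient P.pairingGroup ℍ

/-- The projection of the hyperbolic plane onto the surface. -/
noncomputable def proj (P : IdealPolygon Γ o) (z : ℍ) : P.Surface :=
  Quotient.mk (MulAction.orbitRel P.pairingGroup ℍ) z

/-- The distance of the hyperbolic metric of the surface: the least distance between
representatives in the hyperbolic plane. -/
noncomputable def surfaceDist (P : IdealPolygon Γ o) (x y : P.Surface) : ℝ :=
  sInf {r : ℝ | ∃ z w : ℍ, P.proj z = x ∧ P.proj w = y ∧ r = dist z w}

/-- The complex structure of the surface: a function on an open set `U` is holomorphic if its lift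
to the hyperbolic plane is. -/
def IsHolomorphicOn (P : IdealPolygon Γ o) (f : P.Surface → ℂ) (U : Set P.Surface) : Prop :=
  MDifferentiableOn 𝓘(ℂ) 𝓘(ℂ) (f ∘ P.proj) (P.proj ⁻¹' U)

/-- An isometry of the surface with respect to its hyperbolic metric. -/
def IsIsometric (P : IdealPolygon Γ o) (F : P.Surface ≃ₜ P.Surface) : Prop :=
  ∀ x y, P.surfaceDist (F x) (F y) = P.surfaceDist x y

/-- A conformal automorphism of the surface (an automorphism of the Riemann surface): it and its
inverse pull holomorphic functions on open sets back to holomorphic functions. -/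
def IsConformal (P : IdealPolygon Γ o) (F : P.Surface ≃ₜ P.Surface) : Prop :=
  ∀ (U : Set P.Surface) (f : P.Surface → ℂ), IsOpen U →
    (P.IsHolomorphicOn f U ↔ P.IsHolomorphicOn (f ∘ F) (F ⁻¹' U))

/-- The standard triangle mapped onto the triangle of the surface at the base of the half-edge `d`,
in such a way that `side 0` goes to the side that belongs to `d`. -/
noncomputable def triangleMap (P : IdealPolygon Γ o) (d : D) (z : triangle) : P.Surface :=
  P.proj (P.place (Γ.base d) • rot ^ (P.label d).val • (z : ℍ))

end IdealPolygon

end Surface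

/-! Give each half-edge `d` a frame `m d`, the isometry placing the standard triangle with `side 0`
on the side of `d`. As isometries, `m (next d) = m d * r` for the rotation `r`, and `m (inv d) = m d
* f` for the half-turn `f` if `d` is in the tree; for the other `d` this holds modulo left
multiplication by `G`. Hence a word in the two moves leading from `d` to `e`, with value `x`, gives
`G m(d) x = G m(e)`. By the spanning tree, some word from `d` to `e` has value exactly `(m d)⁻¹ * m
e`. An automorphism `φ` carries this word, with the same value, to one from `φ d` to `φ e`. So `h =
m (φ d₀) * (m d₀)⁻¹` takes every frame `m e` to `m (φ e)` modulo `G` and, by closed words at `d₀`,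
conjugates `G` into itself; with `φ⁻¹`, onto itself. Thus `h` descends to the surface. See
`of_isSpanningTree`, `mul_mul_inv_mem`, `conj_mem_closure`. -/

open IdealTriangle

/-! ### Words in the moves `next` and `inv` -/

namespace HalfEdgeGraph

variable {V D X : Type*} [Group X] {Γ : HalfEdgeGraph V D} {o : Γ.Orientation}

/-- `WordPath o r f d e x`: some word in the moves `next` and `inv` leads from `d` to `e`, and `x`
is its value when `next` is read as `r` and `inv` as `f`. -/
inductive WordPath (o : Γ.Orientation) (r f : X) (d : D) : D → X → Prop
  | refl : WordPath o r f d d 1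
  | next {e : D} {x : X} : WordPath o r f d e x → WordPath o r f d (o.next e) (x * r)
  | inv {e : D} {x : X} : WordPath o r f d e x → WordPath o r f d (Γ.inv e) (x * f)

namespace WordPath

variable {r f : X}

theorem trans {d e k : D} {x y : X} (h : WordPath o r f d e x) (h' : WordPath o r f e k y) :
    WordPath o r f d k (x * y) := by
  induction h' with
  | refl => simpa using h
  | next _ ih => rw [← mul_assoc]; exact ih.next
  | inv _ ih => rw [← mul_assoc]; exact ih.inv

/-- The value depends on the word alone, not on the half-edges it visits. -/
theorem map {ψ : D → D} (hn : ∀ d, ψ (o.next d) = o.next (ψ d))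
    (hi : ∀ d, ψ (Γ.inv d) = Γ.inv (ψ d)) {d e : D} {x : X} (h : WordPath o r f d e x) :
    WordPath o r f (ψ d) (ψ e) x := by
  induction h with
  | refl => exact .refl
  | next _ ih => rw [hn]; exact ih.next
  | inv _ ih => rw [hi]; exact ih.inv

variable {m : D → X} {t : Set D}

theorem of_base_eq (hm : ∀ d, m (o.next d) = m d * r) {d e : D} (h : Γ.base d = Γ.base e) :
    WordPath o r f d e ((m d)⁻¹ * m e) := by
  obtain ⟨n, rfl⟩ := o.cyclic d e h
  clear h
  induction n with
  | zero => simpa using WordPath.refl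
  | succ n ih =>
    rw [pow_succ', Equiv.Perm.mul_apply, hm, ← mul_assoc]
    exact ih.next

theorem of_isWalk (hm : ∀ d, m (o.next d) = m d * r) (ht : ∀ d ∈ t, m (Γ.inv d) = m d * f)
    (l : List D) (hl : ∀ d ∈ l, d ∈ t) {d e : D} (h : Γ.IsWalk (Γ.base d) (Γ.base e) l) :
    WordPath o r f d e ((m d)⁻¹ * m e) := by
  induction l generalizing d with
  | nil => exact of_base_eq hm h
  | cons k l ih =>
    have h1 := (of_base_eq (f := f) hm h.1.symm).inv
    have h2 := ih (fun d hd => hl d (List.mem_cons_of_mem _ hd)) h.2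
    have := h1.trans h2
    rwa [ht k (hl k List.mem_cons_self), show (m d)⁻¹ * m k * f * ((m k * f)⁻¹ * m e)
      = (m d)⁻¹ * m e by group] at this

theorem of_isSpanningTree (hm : ∀ d, m (o.next d) = m d * r)
    (ht : ∀ d ∈ t, m (Γ.inv d) = m d * f) (hs : Γ.IsSpanningTree t) (d e : D) :
    WordPath o r f d e ((m d)⁻¹ * m e) := by
  obtain ⟨l, ⟨hl, -, hlt⟩, -⟩ := hs.2.2 (Γ.base d) (Γ.base e)
  exact of_isWalk hm ht l hlt hl

/-- Each move preserves the coset relation `G m(d) x = G m(e)`: `hm` settles `next`, `hG` settles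
`inv`. -/
theorem mul_mul_inv_mem {G : Subgroup X} (hm : ∀ d, m (o.next d) = m d * r)
    (hG : ∀ d, m d * f * (m (Γ.inv d))⁻¹ ∈ G) {d e : D} {x : X} (h : WordPath o r f d e x) :
    m d * x * (m e)⁻¹ ∈ G := by
  induction h with
  | refl => simp
  | next _ ih => rw [hm]; convert ih using 1; group
  | @inv e x _ ih => convert G.mul_mem ih (hG e) using 1; group

end WordPath

variable {r f : X} {m : D → X} {t : Set D}

/-- A map of half-edges that commutes with `next` and `inv` moves the frames `m` by conjugation
into the group generated by the side pairings. -/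
theorem conj_mem_closure (hm : ∀ d, m (o.next d) = m d * r)
    (ht : ∀ d ∈ t, m (Γ.inv d) = m d * f) (hs : Γ.IsSpanningTree t) {ψ : D → D}
    (hn : ∀ d, ψ (o.next d) = o.next (ψ d)) (hi : ∀ d, ψ (Γ.inv d) = Γ.inv (ψ d)) (d₀ : D)
    {G : Subgroup X} (hG : G = Subgroup.closure ((fun d => m d * f * (m (Γ.inv d))⁻¹) '' tᶜ)) :
    (∀ g ∈ G, m (ψ d₀) * (m d₀)⁻¹ * g * (m (ψ d₀) * (m d₀)⁻¹)⁻¹ ∈ G) ∧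
      ∀ d, m (ψ d₀) * (m d₀)⁻¹ * m d * (m (ψ d))⁻¹ ∈ G := by
  have hG' : ∀ d, m d * f * (m (Γ.inv d))⁻¹ ∈ G := fun d => by
    by_cases hd : d ∈ t
    · rw [ht d hd, mul_inv_cancel]; exact G.one_mem
    · rw [hG]; exact Subgroup.subset_closure ⟨d, hd, rfl⟩
  have path := WordPath.of_isSpanningTree hm ht hs
  refine ⟨fun g hg => ?_, fun d => ?_⟩
  · suffices G ≤ G.comap (MulAut.conj (m (ψ d₀) * (m d₀)⁻¹)).toMonoidHom from this hg
    conv_lhs => rw [hG]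
    rw [Subgroup.closure_le]
    rintro _ ⟨d, -, rfl⟩
    -- The word runs from `d₀` to `d`, across the edge, and back to `d₀`. Its value is the generator
    -- of `d` conjugated by `m d₀`; the image word is closed at `ψ d₀`.
    have := (((path d₀ d).inv.trans (path (Γ.inv d) d₀)).map hn hi).mul_mul_inv_mem hm hG'
    change m (ψ d₀) * (m d₀)⁻¹ * (m d * f * (m (Γ.inv d))⁻¹) * (m (ψ d₀) * (m d₀)⁻¹)⁻¹ ∈ G
    convert this using 1
    group
  · convert ((path d₀ d).map hn hi).mul_mul_inv_mem hm hG' using 1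
    group

end HalfEdgeGraph

/-! ### Frames of the polygon -/

namespace IdealPolygon

variable {V D : Type*} {Γ : HalfEdgeGraph V D} {o : Γ.Orientation} (P : IdealPolygon Γ o)

/-- The isometry that takes the standard triangle to the triangle at the base of `d`, and `side 0`
to the side of `d`. -/
def frame (d : D) : SL(2, ℝ) := P.place (Γ.base d) * rot ^ (P.label d).val

theorem triangleMap_eq (d : D) (z : triangle) :
    P.triangleMap d z = P.proj (P.frame d • (z : ℍ)) := by
  rw [triangleMap, frame, mul_smul]

theorem sidePairing_eq (d : D) :
    P.sidePairing d = P.frame d * IdealTriangle.flip * (P.frame (Γ.inv d))⁻¹ := by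
  simp only [sidePairing, frame, glue]
  group

theorem proj_eq_proj {z w : ℍ} : P.proj z = P.proj w ↔ ∃ g ∈ P.pairingGroup, g • w = z := by
  unfold proj
  rw [Quotient.eq, MulAction.orbitRel_apply, MulAction.mem_orbit_iff]
  exact ⟨fun ⟨g, hg⟩ => ⟨g, g.2, hg⟩, fun ⟨g, hg, h⟩ => ⟨⟨g, hg⟩, h⟩⟩

theorem surjective_proj : Function.Surjective P.proj := Quotient.mk_surjective

theorem continuous_proj : Continuous P.proj := continuous_quotient_mk'

/-- The group of the side pairings, as a group of permutations of the hyperbolic plane. -/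
noncomputable def permGroup : Subgroup (Equiv.Perm ℍ) :=
  P.pairingGroup.map (MulAction.toPermHom SL(2, ℝ) ℍ)

local notation "π" => MulAction.toPermHom SL(2, ℝ) ℍ

/-- In `SL(2, ℝ)` the cube of `rot` is `-1`, so the frame relations are stated for permutations of
`ℍ`. -/
theorem toPermHom_rot_pow_three : π rot ^ 3 = 1 := by
  ext1 z
  exact rot_rot_rot z

theorem toPermHom_frame_next (d : D) :
    π (P.frame (o.next d)) = π (P.frame d) * π rot := by
  have key : ∀ k : ZMod 3, π rot ^ (k + 1).val = π rot ^ k.val * π rot := by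
    intro k
    rw [← pow_succ]
    fin_cases k
    · rfl
    · rfl
    -- Here the label 2 wraps around to 0.
    · exact toPermHom_rot_pow_three.symm
  rw [frame, frame, o.base_next, P.label_next, map_mul, map_mul, map_pow, map_pow, key, mul_assoc]

theorem toPermHom_frame_inv {d : D} (hd : d ∈ P.tree) :
    π (P.frame (Γ.inv d)) = π (P.frame d) * π IdealTriangle.flip := by
  have h : π (P.place (Γ.base (Γ.inv d)))
      = π (P.place (Γ.base d)) * π (glue (P.label d) (P.label (Γ.inv d))) := by
    ext1 z
    exact P.place_tree d hd z
  rw [frame, frame, map_mul, h, glue]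
  simp only [map_mul, map_inv]
  group

theorem permGroup_eq : P.permGroup = Subgroup.closure
    ((fun d => π (P.frame d) * π IdealTriangle.flip * (π (P.frame (Γ.inv d)))⁻¹) '' P.treeᶜ) := by
  rw [permGroup, pairingGroup, MonoidHom.map_closure, Set.image_image]
  simp only [sidePairing_eq, map_mul, map_inv]

theorem proj_eq_of_mem_permGroup {g : Equiv.Perm ℍ} (hg : g ∈ P.permGroup) (z : ℍ) :
    P.proj (g z) = P.proj z := by
  obtain ⟨g, hg, rfl⟩ := hg
  exact P.proj_eq_proj.2 ⟨g, hg, rfl⟩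

/-! ### Descent to the surface -/

/-- An isometry of the hyperbolic plane that normalizes the group of the side pairings up to sign,
as a transformation of the surface. -/
noncomputable def descend (h : SL(2, ℝ))
    (hh : ∀ z w, P.proj (h • z) = P.proj (h • w) ↔ P.proj z = P.proj w) :
    P.Surface ≃ₜ P.Surface where
  toFun := Quotient.lift (fun z => P.proj (h • z)) fun z w e => (hh z w).2 (Quotient.sound e)
  invFun := Quotient.lift (fun z => P.proj (h⁻¹ • z)) fun z w e => by
    rw [← hh, smul_inv_smul, smul_inv_smul]; exact Quotient.sound e
  left_inv x := by
    obtain ⟨z, rfl⟩ := P.surjective_proj x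
    change P.proj (h⁻¹ • h • z) = _
    rw [inv_smul_smul]
  right_inv x := by
    obtain ⟨z, rfl⟩ := P.surjective_proj x
    change P.proj (h • h⁻¹ • z) = _
    rw [smul_inv_smul]
  continuous_toFun := (P.continuous_proj.comp (continuous_const_smul h)).quotient_lift _
  continuous_invFun := (P.continuous_proj.comp (continuous_const_smul h⁻¹)).quotient_lift _

variable {P} {h : SL(2, ℝ)}
  (hh : ∀ z w, P.proj (h • z) = P.proj (h • w) ↔ P.proj z = P.proj w)

theorem descend_proj (z : ℍ) : P.descend h hh (P.proj z) = P.proj (h • z) := rfl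

theorem descend_proj_inv_smul (z : ℍ) : P.descend h hh (P.proj (h⁻¹ • z)) = P.proj z := by
  rw [descend_proj, smul_inv_smul]

/-- Since `h` preserves distances and matches the representatives of `x`, `y` with those of their
images, both infima run over the same set. -/
theorem isIsometric_descend : P.IsIsometric (P.descend h hh) := by
  intro x y
  unfold surfaceDist
  congr 1
  ext s
  constructor
  · rintro ⟨z, w, hz, hw, rfl⟩
    rw [← descend_proj_inv_smul hh, (P.descend h hh).injective.eq_iff] at hz hw
    exact ⟨_, _, hz, hw, (dist_smul h⁻¹ z w).symm⟩
  · rintro ⟨z, w, rfl, rfl, rfl⟩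
    exact ⟨h • z, h • w, rfl, rfl, (dist_smul h z w).symm⟩

/-- The lift of `f ∘ F` is the lift of `f` composed with the Möbius map `h`, which is biholomorphic.
-/
theorem isConformal_descend : P.IsConformal (P.descend h hh) := by
  intro U f _
  have hs : ∀ g : SL(2, ℝ), MDifferentiable 𝓘(ℂ) 𝓘(ℂ) (fun z : ℍ => g • z) := fun g =>
    mdifferentiable_smul (g := (g : GL (Fin 2) ℝ)) (by simp)
  unfold IsHolomorphicOn
  constructor
  · intro hf
    exact hf.comp (hs h).mdifferentiableOn fun z hz => hz
  · intro hf
    have := hf.comp (s := P.proj ⁻¹' U) (hs h⁻¹).mdifferentiableOn fun z hz => by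
      change P.descend h hh (P.proj (h⁻¹ • z)) ∈ U
      rwa [descend_proj_inv_smul]
    refine this.congr fun z _ => ?_
    change f _ = f (P.descend h hh (P.proj (h⁻¹ • z)))
    rw [descend_proj_inv_smul]

end IdealPolygon

/-! ### The induced automorphism -/

theorem mainTheorem11 {V D : Type*} (Γ : HalfEdgeGraph V D) (hΓ : Γ.IsThreeRegular)
    (o : Γ.Orientation) (P : IdealPolygon Γ o) (φ : Γ.Aut) (hφ : φ.OrientationPreserving o) :
    ∃ F : P.Surface ≃ₜ P.Surface, P.IsConformal F ∧ P.IsIsometric F ∧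
      ∀ (d : D) (z : IdealTriangle.triangle),
        F (P.triangleMap d z) = P.triangleMap (φ.onHalf d) z := by
  obtain ⟨v⟩ := P.isSpanningTree.1
  obtain ⟨d₀, -⟩ : {d | Γ.base d = v}.Nonempty :=
    Set.nonempty_of_ncard_ne_zero (by rw [hΓ v]; decide)
  have conj := fun (ψ : D → D) hn hi d => HalfEdgeGraph.conj_mem_closure (ψ := ψ)
    P.toPermHom_frame_next (fun _ => P.toPermHom_frame_inv) P.isSpanningTree hn hi d P.permGroup_eq
  obtain ⟨h1, hd⟩ := conj φ.onHalf hφ (fun d => (φ.inv_onHalf d).symm) d₀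
  -- For `φ⁻¹` based at `φ d₀` the conjugating element is `m d₀ * (m (φ d₀))⁻¹`, the inverse of the
  -- one for `φ`.
  obtain ⟨h2, -⟩ := conj φ.onHalf.symm
    (fun d => by rw [Equiv.symm_apply_eq, hφ, Equiv.apply_symm_apply])
    (fun d => by rw [Equiv.symm_apply_eq, ← φ.inv_onHalf, Equiv.apply_symm_apply]) (φ.onHalf d₀)
  rw [Equiv.symm_apply_apply] at h2
  have descends : ∀ k : SL(2, ℝ), (∀ g ∈ P.permGroup, MulAction.toPermHom SL(2, ℝ) ℍ k * g *
      (MulAction.toPermHom SL(2, ℝ) ℍ k)⁻¹ ∈ P.permGroup) →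
      ∀ z w, P.proj z = P.proj w → P.proj (k • z) = P.proj (k • w) := by
    intro k hk z w e
    obtain ⟨g, hg, rfl⟩ := P.proj_eq_proj.1 e
    have := P.proj_eq_of_mem_permGroup (hk _ ⟨g, hg, rfl⟩) (k • w)
    rw [← this, ← map_inv, ← map_mul, ← map_mul, MulAction.toPermHom_apply,
      MulAction.toPerm_apply, mul_smul, mul_smul, inv_smul_smul]
  set h := P.frame (φ.onHalf d₀) * (P.frame d₀)⁻¹ with h_def
  have hh : ∀ z w, P.proj (h • z) = P.proj (h • w) ↔ P.proj z = P.proj w := by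
    intro z w
    refine ⟨fun e => ?_, descends h (by simpa only [h_def, map_mul, map_inv] using h1) z w⟩
    have := descends h⁻¹ (by simpa only [h_def, mul_inv_rev, inv_inv, map_mul, map_inv] using h2) _ _ e
    rwa [inv_smul_smul, inv_smul_smul] at this
  refine ⟨P.descend h hh, IdealPolygon.isConformal_descend hh,
    IdealPolygon.isIsometric_descend hh, fun d z => ?_⟩
  rw [P.triangleMap_eq, P.triangleMap_eq, IdealPolygon.descend_proj]
  -- The element `h * m d * (m (φ d))⁻¹` of the group takes `m (φ d) • z` to `h • m d • z`.
  have := P.proj_eq_of_mem_permGroup (hd d) (P.frame (φ.onHalf d) • (z : ℍ))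
  rw [← this, ← map_inv, ← map_inv, ← map_mul, ← map_mul, ← map_mul, MulAction.toPermHom_apply,
    MulAction.toPerm_apply, ← mul_smul, ← mul_smul, inv_mul_cancel_right]
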